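/- **Notation.** Let $\mathbb N=\{1,2,\dots\}$ and $[n]=\{1,\dots,n\}$. A *DNN* is a tuple $\Phi=((W_1,b_1),\dots,(W_L,b_L))$ with $L\in\mathbb N$, $W_k\in\mathbb R^{\ell_k\times\ell_{k-1}}$, $b_k\in\mathbb R^{\ell_k}$, $\ell_0,\dots,\ell_L\in\mathbb N$. Its number of parameters is $\mathcal P(\Phi)=\sum_{k=1}^L\ell_k(\ell_{k-1}+1)$. With $A_k(x)=W_kx+b_k$ and $\mathfrak r(x)=(\max\{x_j,0\})_j$, its realization is $\mathcal R(\Phi)=A_L\circ\mathfrak r\circ A_{L-1}\circ\cdots\circ\mathfrak r\circ A_1\in C(\mathbb R^{\ell_0},\mathbb R^{\ell_L})$. An $m$-dimensional *hypercube* is a set $Q=[a,b]^m$ with real numbers $a<b$. For functions $f_j\colon[a,b]^{d_j}\to\mathbb R$, $j\in[n]$, $d_j\in\mathbb N$, $\sum_j d_j=m$, their *parallelization* is the map $[a,b]^m\to\mathbb R^n$, $(x_1,\dots,x_n)\mapsto(f_1(x_1),\dots,f_n(x_n))$, where $x_j\in[a,b]^{d_j}$ are the consecutive blocks of the argument. For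 $Q=[a,b]^m$ let * $\mathscr P_{c,1}(Q,1)$ be the set of all parallelizations on $Q$ of functions $f_j\colon[a,b]^{d_j}\to\mathbb R$ with $d_j\le c$ and $|f_j(x)-f_j(y)|\le\|x-y\|_1$ for all $x,y\in[a,b]^{d_j}$; * $\mathbf M(Q)$ be the set of all parallelizations on $Q$ of maximum functions $(x_1,\dots,x_r)\mapsto\max\{x_1,\dots,x_r\}$, $r\in\mathbb N$; * $\mathbf P(Q)$ be the set of all parallelizations on $Q$ of product functions $(x_1,\dots,x_r)\mapsto\prod_{i=1}^r x_i$, $r\in\mathbb N$. In each case the number $n$ of blocks and the sizes $d_j$ are arbitrary (subject to $\sum_j d_j=m$ and the stated bounds). **Theorem.** Let $c\in\mathbb N$. For every $d\in\mathbb N$ let $\mathbf k(d)\in[cd^c]$ and $\mathfrak d^d_1,\dots,\mathfrak d^d_{\mathbf k(d)+1}\in[cd^c]$. For every $d\in\mathbb N$, $i\in[\mathbf k(d)]$ let $Q_i^d\subseteq[-cd^c,cd^c]^{\mathfrak d_i^d}$ be a $\mathfrak d_i^d$-dimensional hypercube and let $g_i^d\in C(Q_i^d,\mathbb R^{\mathfrak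 d_{i+1}^d})$ satisfy $$g_i^d\in\mathscr P_{c,1}(Q_i^d,1)\cup\mathbf M(Q_i^d)\cup\mathbf P(Q_i^d).$$ Assume that $g_i^d(Q_i^d)\subseteq Q_{i+1}^d$ for all $d\in\mathbb N$, $i\in[\mathbf k(d)-1]$, and that $Q_i^d\subseteq[-\tfrac18,\tfrac18]^{\mathfrak d_i^d}$ for all $d\in\mathbb N$, $i\in[\mathbf k(d)]$ with $g_i^d\in\mathbf P(Q_i^d)$. For every $d\in\mathbb N$ let $F_d=g^d_{\mathbf k(d)}\circ g^d_{\mathbf k(d)-1}\circ\cdots\circ g_1^d\colon Q_1^d\to\mathbb R^{\mathfrak d^d_{\mathbf k(d)+1}}$. Then there exists $K\in\mathbb N$ such that for every $d\in\mathbb N$ and every $\varepsilon\in(0,1]$ there exists a DNN $\Phi$ with $\mathcal R(\Phi)\in C(\mathbb R^{\mathfrak d_1^d},\mathbb R^{\mathfrak d^d_{\mathbf k(d)+1}})$, $$\mathcal P(\Phi)\le Kd^K\varepsilon^{-2c}\qquad\text{and}\qquad\forall x\in Q_1^d\colon\ \|\mathcal R(\Phi)(x)-F_d(x)\|_1\le\varepsilon.$$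 -/

import Mathlib

namespace DNNApprox

/-- Fully connected feedforward networks with input dimension `m` and output dimension `n`:
a nonempty list of pairs `(W_k, b_k)` of a weight matrix and a bias vector with matching
dimensions. All layer dimensions `ℓ_0, …, ℓ_L` are positive.
`affine W b` is the network `((W, b))` with one layer, and `layer W b Φ` is the network `Φ`
with the layer `(W, b)` put in front of its first layer. -/
inductive DNN : ℕ → ℕ → Type
  | affine {m n : ℕ} (hm : 0 < m) (hn : 0 < n)
      (W : Matrix (Fin n) (Fin m) ℝ) (b : Fin n → ℝ) : DNN m n
  | layer {m l n : ℕ} (hm : 0 < m)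
      (W : Matrix (Fin l) (Fin m) ℝ) (b : Fin l → ℝ) (Φ : DNN l n) : DNN m n

/-- The multidimensional rectified linear unit. -/
noncomputable def relu {l : ℕ} (x : Fin l → ℝ) : Fin l → ℝ := fun i => max (x i) 0

/-- The realization `A_L ∘ relu ∘ A_{L-1} ∘ ⋯ ∘ relu ∘ A_1` with `A_k x = W_k x + b_k`. -/
noncomputable def DNN.realize : {m n : ℕ} → DNN m n → (Fin m → ℝ) → (Fin n → ℝ)
  | _, _, .affine _ _ W b => fun x => W.mulVec x + b
  | _, _, .layer _ W b Φ => fun x => Φ.realize (relu (W.mulVec x + b))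

/-- The number of parameters `∑_k ℓ_k (ℓ_{k-1} + 1)`. -/
def DNN.numParams : {m n : ℕ} → DNN m n → ℕ
  | m, n, .affine _ _ _ _ => n * (m + 1)
  | m, _, .layer (l := l) _ _ _ Φ => l * (m + 1) + Φ.numParams

/-- The `ℓ₁`-norm on `ℝ^n`. -/
def l1norm {n : ℕ} (x : Fin n → ℝ) : ℝ := ∑ i, |x i|

/-- The cube `[a, b]^m`. -/
def cube (m : ℕ) (a b : ℝ) : Set (Fin m → ℝ) := {x | ∀ i, x i ∈ Set.Icc a b}

/-- For `d_1 + ⋯ + d_n = m` (the sizes are `δ`), a vector of `ℝ^m` is a concatenation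
`(x_1, …, x_n)` of consecutive blocks `x_j` of length `d_j`; this is the block `x_j`. -/
def block {m n : ℕ} (δ : Fin n → ℕ) (hδ : ∑ j, δ j = m) (x : Fin m → ℝ) (j : Fin n) :
    Fin (δ j) → ℝ :=
  fun t => x (Fin.cast hδ (finSigmaFinEquiv ⟨j, t⟩))

/-- The parallelization `f_1 □ ⋯ □ f_n : (x_1, …, x_n) ↦ (f_1 x_1, …, f_n x_n)` of
real-valued functions `f_j` of `d_j` variables. -/
def parallelization {m n : ℕ} (δ : Fin n → ℕ) (hδ : ∑ j, δ j = m)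
    (f : (j : Fin n) → (Fin (δ j) → ℝ) → ℝ) (x : Fin m → ℝ) : Fin n → ℝ :=
  fun j => f j (block δ hδ x j)

/-- Parallelizations on `[a, b]^m` of functions of at most `k` variables which are
`L`-Lipschitz on their cube with respect to the `ℓ₁`-norm. -/
def IsLipschitzParallel (k : ℕ) (L : ℝ) {m n : ℕ} (a b : ℝ)
    (g : (Fin m → ℝ) → (Fin n → ℝ)) : Prop :=
  ContinuousOn g (cube m a b) ∧
  ∃ (δ : Fin n → ℕ) (hδ : ∑ j, δ j = m) (f : (j : Fin n) → (Fin (δ j) → ℝ) → ℝ),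
    (∀ j, 1 ≤ δ j ∧ δ j ≤ k) ∧
    (∀ j, ∀ x ∈ cube (δ j) a b, ∀ y ∈ cube (δ j) a b,
      |f j x - f j y| ≤ L * l1norm (x - y)) ∧
    Set.EqOn g (parallelization δ hδ f) (cube m a b)

/-- Parallelizations on `[a, b]^m` of maximum functions `(x_1, …, x_r) ↦ max {x_1, …, x_r}`
with `r ≥ 1` (so that the supremum is over a finite nonempty family). -/
def IsMaxParallel {m n : ℕ} (a b : ℝ) (g : (Fin m → ℝ) → (Fin n → ℝ)) : Prop :=
  ContinuousOn g (cube m a b) ∧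
  ∃ (δ : Fin n → ℕ) (hδ : ∑ j, δ j = m),
    (∀ j, 1 ≤ δ j) ∧
    Set.EqOn g (parallelization δ hδ (fun _ x => ⨆ t, x t)) (cube m a b)

/-- Parallelizations on `[a, b]^m` of product functions `(x_1, …, x_r) ↦ x_1 ⋯ x_r`
with `r ≥ 1`. -/
def IsProdParallel {m n : ℕ} (a b : ℝ) (g : (Fin m → ℝ) → (Fin n → ℝ)) : Prop :=
  ContinuousOn g (cube m a b) ∧
  ∃ (δ : Fin n → ℕ) (hδ : ∑ j, δ j = m),
    (∀ j, 1 ≤ δ j) ∧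
    Set.EqOn g (parallelization δ hδ (fun _ x => ∏ t, x t)) (cube m a b)

/-- The composition `g_{k-1} ∘ ⋯ ∘ g_1 ∘ g_0` of `g_i : ℝ^{D i} → ℝ^{D (i+1)}`. -/
def compose (D : ℕ → ℕ) (g : (i : ℕ) → (Fin (D i) → ℝ) → (Fin (D (i + 1)) → ℝ)) :
    (k : ℕ) → (Fin (D 0) → ℝ) → (Fin (D k) → ℝ)
  | 0 => id
  | k + 1 => fun x => g k (compose D g k x)

end DNNApprox

/-! All three kinds of maps are 1-Lipschitz for the `ℓ₁`-norm on their cubes (products because the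
entries have modulus at most 1). Hence errors along the composition only add up, provided each
approximate value is first projected onto the next cube; the projection costs one hidden layer and
does not increase the error (`exists_net_compose`). With `k ≤ B = c * d ^ c` stages it suffices to
approximate each stage up to `ε / B`.

A Lipschitz function of `c` variables is approximated by the maximum of the functions `φ q - ‖x -
q‖₁` over a grid of `N ^ c` points `q`. A product is a chain of binary multiplications, each
approximated in the same way with `N ^ 2` points; maxima are exact. The maxima are evaluated
sequentially (`ReluNet.sup'`), so the accuracy affects only the depth, while the width stays
polynomial in `d`. The number of parameters is linear in the depth, which is of order `N ^ (2 * c)`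
with `N` of order `1 / ε`, up to powers of `d`; this gives `ε ^ (-2c)`. -/

namespace DNNApprox

/-! ### Affine maps and ReLU networks with arbitrary index types. -/

/-- Real-valued affine functions of finitely many real variables. -/
def IsAffine {ι : Type} [Fintype ι] (f : (ι → ℝ) → ℝ) : Prop :=
  ∃ (w : ι → ℝ) (b : ℝ), ∀ x, f x = ∑ i, w i * x i + b

namespace IsAffine

variable {ι κ : Type} [Fintype ι] [Fintype κ]

theorem const (b : ℝ) : IsAffine fun _ : ι → ℝ => b := ⟨0, b, by simp⟩

theorem coord (i : ι) : IsAffine fun x : ι → ℝ => x i := by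
  classical
  exact ⟨Pi.single i 1, 0, fun x => by simp [Pi.single_apply]⟩

theorem add {f g : (ι → ℝ) → ℝ} (hf : IsAffine f) (hg : IsAffine g) :
    IsAffine fun x => f x + g x := by
  obtain ⟨w, b, hf⟩ := hf
  obtain ⟨v, c, hg⟩ := hg
  refine ⟨w + v, b + c, fun x => ?_⟩
  simp only [hf, hg, Pi.add_apply, add_mul, Finset.sum_add_distrib]
  ring

theorem const_mul {f : (ι → ℝ) → ℝ} (hf : IsAffine f) (r : ℝ) :
    IsAffine fun x => r * f x := by
  obtain ⟨w, b, hf⟩ := hf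
  refine ⟨fun i => r * w i, r * b, fun x => ?_⟩
  simp only [hf, mul_add, Finset.mul_sum, mul_assoc]

theorem neg {f : (ι → ℝ) → ℝ} (hf : IsAffine f) : IsAffine fun x => -f x := by
  simpa using hf.const_mul (-1)

theorem sub {f g : (ι → ℝ) → ℝ} (hf : IsAffine f) (hg : IsAffine g) :
    IsAffine fun x => f x - g x := by
  simpa [sub_eq_add_neg] using hf.add hg.neg

theorem sum {σ : Type} (s : Finset σ) {f : σ → (ι → ℝ) → ℝ} (hf : ∀ t, IsAffine (f t)) :
    IsAffine fun x => ∑ t ∈ s, f t x := by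
  classical
  induction s using Finset.induction_on with
  | empty => simpa using const 0
  | insert a s ha ih => simpa [Finset.sum_insert ha] using (hf a).add ih

theorem comp {f : (κ → ℝ) → ℝ} (hf : IsAffine f) {A : (ι → ℝ) → κ → ℝ}
    (hA : ∀ j, IsAffine fun x => A x j) : IsAffine fun x => f (A x) := by
  obtain ⟨w, b, hf⟩ := hf
  simp only [hf]
  exact (sum _ fun j => (hA j).const_mul (w j)).add (const b)

end IsAffine

/-- Maps computed by a ReLU network with at most `L` hidden layers, all of width at most `w`,
between spaces of real vectors with arbitrary finite index types. -/
inductive ReluNet (w : ℕ) {κ : Type} :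
    ℕ → {ι : Type} → [Fintype ι] → ((ι → ℝ) → κ → ℝ) → Prop
  | affine (L : ℕ) {ι : Type} [Fintype ι] (A : (ι → ℝ) → κ → ℝ)
      (hA : ∀ j, IsAffine fun x => A x j) : ReluNet w L A
  | layer {L : ℕ} {ι σ : Type} [Fintype ι] [Fintype σ] [Nonempty σ] (A : (ι → ℝ) → σ → ℝ)
      (hA : ∀ j, IsAffine fun x => A x j) (hσ : Fintype.card σ ≤ w) (f : (σ → ℝ) → κ → ℝ)
      (hf : ReluNet w L f) : ReluNet w (L + 1) fun x => f fun s => max (A x s) 0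

namespace ReluNet

variable {ι κ σ : Type} [Fintype ι] [Fintype σ] {w : ℕ}

theorem mono {L L' : ℕ} (hL : L ≤ L') {f : (ι → ℝ) → κ → ℝ} (hf : ReluNet w L f) :
    ReluNet w L' f := by
  induction hf generalizing L' with
  | affine L A hA => exact affine _ A hA
  | layer A hA hσ f hf ih =>
    obtain ⟨M, rfl⟩ : ∃ M, L' = M + 1 := ⟨L' - 1, by omega⟩
    exact layer A hA hσ f (ih (by omega))

theorem comp_affine {L : ℕ} {f : (σ → ℝ) → κ → ℝ} (hf : ReluNet w L f)
    {A : (ι → ℝ) → σ → ℝ} (hA : ∀ j, IsAffine fun x => A x j) :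
    ReluNet w L fun x => f (A x) := by
  cases hf with
  | affine L B hB => exact affine _ _ fun j => (hB j).comp hA
  | layer B hB hσ f hf => exact layer (fun x => B (A x)) (fun j => (hB j).comp hA) hσ f hf

/-- The affine output map of the inner network merges with the affine input map of the outer one, so
hidden layers simply add. -/
theorem comp {L M : ℕ} {f : (σ → ℝ) → κ → ℝ} {g : (ι → ℝ) → σ → ℝ} (hf : ReluNet w L f)
    (hg : ReluNet w M g) : ReluNet w (L + M) fun x => f (g x) := by
  induction hg with
  | affine M A hA => exact (hf.comp_affine hA).mono (Nat.le_add_right _ _)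
  | layer A hA hσ g hg ih => exact layer A hA hσ (fun x => f (g x)) ih

/-- A map with affine coordinate functions is given by a matrix and a vector. -/
theorem exists_matrix {m n : ℕ} (A : (Fin m → ℝ) → Fin n → ℝ)
    (hA : ∀ j, IsAffine fun x => A x j) :
    ∃ (W : Matrix (Fin n) (Fin m) ℝ) (b : Fin n → ℝ), ∀ x, W.mulVec x + b = A x := by
  choose W b h using hA
  exact ⟨W, b, fun x => funext fun j => by simp [Matrix.mulVec, dotProduct, h]⟩

/-- A map computed by a `ReluNet` is, up to numbering of the coordinates, the realization of a
`DNN`. -/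
theorem exists_dnn {L : ℕ} {f : (ι → ℝ) → κ → ℝ} (hf : ReluNet w L f) {m n : ℕ}
    (e : Fin m ≃ ι) (e' : Fin n ≃ κ) (hm : 0 < m) (hn : 0 < n) (hmw : m ≤ w) (hnw : n ≤ w) :
    ∃ Φ : DNN m n, (∀ x, Φ.realize x = fun j => f (fun i => x (e.symm i)) (e' j)) ∧
      Φ.numParams ≤ (L + 1) * (w * (w + 1)) := by
  induction hf generalizing m with
  | affine L A hA =>
    obtain ⟨W, b, h⟩ := exists_matrix (fun x j => A (fun i => x (e.symm i)) (e' j))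
      fun j => (hA (e' j)).comp fun i => IsAffine.coord (e.symm i)
    refine ⟨.affine hm hn W b, fun x => h x, ?_⟩
    simp only [DNN.numParams]
    calc n * (m + 1) ≤ w * (w + 1) := by gcongr
      _ ≤ (L + 1) * (w * (w + 1)) := Nat.le_mul_of_pos_left _ (by omega)
  | @layer L ι σ _ _ _ A hA hσ f hf ih =>
    have e₁ : Fin (Fintype.card σ) ≃ σ := (Fintype.equivFin σ).symm
    obtain ⟨Φ, hΦ, hP⟩ := ih e₁ Fintype.card_pos hσ
    obtain ⟨W, b, h⟩ := exists_matrix (fun x j => A (fun i => x (e.symm i)) (e₁ j))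
      fun j => (hA (e₁ j)).comp fun i => IsAffine.coord (e.symm i)
    refine ⟨.layer hm W b Φ, fun x => ?_, ?_⟩
    · simp [DNN.realize, h, hΦ, relu]
    · simp only [DNN.numParams]
      calc Fintype.card σ * (m + 1) + Φ.numParams
          ≤ w * (w + 1) + (L + 1) * (w * (w + 1)) := by gcongr
        _ = (L + 1 + 1) * (w * (w + 1)) := by ring

end ReluNet

theorem DNN.continuous_realize {m n : ℕ} (Φ : DNN m n) : Continuous Φ.realize := by
  induction Φ with
  | affine hm hn W b =>
    exact (Continuous.matrix_mulVec continuous_const continuous_id).add continuous_const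
  | layer hm W b Φ ih =>
    refine ih.comp (continuous_pi fun i => ?_)
    exact ((continuous_apply i).comp ((Continuous.matrix_mulVec continuous_const
      continuous_id).add continuous_const)).max continuous_const

/-! ### Functions with one hidden layer. -/

/-- Linear combinations, up to a constant, of at most `N` functions `x ↦ max (A x) 0` with
affine `A`. -/
def Shallow {ι : Type} [Fintype ι] (N : ℕ) (f : (ι → ℝ) → ℝ) : Prop :=
  ∃ (σ : Type) (_ : Fintype σ) (c : σ → ℝ) (A : σ → (ι → ℝ) → ℝ) (b : ℝ),
    Fintype.card σ ≤ N ∧ (∀ s, IsAffine (A s)) ∧ ∀ x, f x = ∑ s, c s * max (A s x) 0 + b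

namespace Shallow

variable {ι κ : Type} [Fintype ι] [Fintype κ]

theorem mono {N M : ℕ} (h : N ≤ M) {f : (ι → ℝ) → ℝ} (hf : Shallow N f) : Shallow M f := by
  obtain ⟨σ, i, c, A, b, hN, hA, hf⟩ := hf
  exact ⟨σ, i, c, A, b, hN.trans h, hA, hf⟩

theorem const (b : ℝ) : Shallow 0 fun _ : ι → ℝ => b :=
  ⟨Empty, inferInstance, fun _ => 0, fun _ _ => 0, b, by simp, by simp, by simp⟩

theorem relu {f : (ι → ℝ) → ℝ} (hf : IsAffine f) : Shallow 1 fun x => max (f x) 0 :=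
  ⟨Unit, inferInstance, fun _ => 1, fun _ => f, 0, by simp, fun _ => hf, by simp⟩

theorem add {N M : ℕ} {f g : (ι → ℝ) → ℝ} (hf : Shallow N f) (hg : Shallow M g) :
    Shallow (N + M) fun x => f x + g x := by
  obtain ⟨σ, i, c, A, b, hN, hA, hf⟩ := hf
  obtain ⟨τ, j, c', A', b', hN', hA', hg⟩ := hg
  refine ⟨σ ⊕ τ, inferInstance, Sum.elim c c', Sum.elim A A', b + b', ?_, ?_, fun x => ?_⟩
  · simpa using Nat.add_le_add hN hN'
  · rintro (s | s)
    exacts [hA s, hA' s]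
  · simp only [hf, hg, Fintype.sum_sum_type, Sum.elim_inl, Sum.elim_inr]
    ring

theorem const_mul {N : ℕ} {f : (ι → ℝ) → ℝ} (hf : Shallow N f) (r : ℝ) :
    Shallow N fun x => r * f x := by
  obtain ⟨σ, i, c, A, b, hN, hA, hf⟩ := hf
  refine ⟨σ, i, fun s => r * c s, A, r * b, hN, hA, fun x => ?_⟩
  simp only [hf, mul_add, Finset.mul_sum, mul_assoc]

theorem sub {N M : ℕ} {f g : (ι → ℝ) → ℝ} (hf : Shallow N f) (hg : Shallow M g) :
    Shallow (N + M) fun x => f x - g x := by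
  have h := hf.add (hg.const_mul (-1))
  simpa only [neg_one_mul, ← sub_eq_add_neg] using h

theorem sum {σ : Type} (s : Finset σ) {N : ℕ} {f : σ → (ι → ℝ) → ℝ}
    (hf : ∀ t, Shallow N (f t)) : Shallow (s.card * N) fun x => ∑ t ∈ s, f t x := by
  classical
  induction s using Finset.induction_on with
  | empty => simpa using const 0
  | insert a s ha ih =>
    simp only [Finset.sum_insert ha]
    refine ((hf a).add ih).mono (le_of_eq ?_)
    rw [Finset.card_insert_of_notMem ha]
    ring

/-- Uses `t = max t 0 - max (-t) 0`; this lets a layer pass values on unchanged. -/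
theorem of_affine {f : (ι → ℝ) → ℝ} (hf : IsAffine f) : Shallow 2 f := by
  have h := (relu hf).sub (relu hf.neg)
  convert h using 2 with x
  rcases le_total (f x) 0 with h | h
  · rw [max_eq_right h, max_eq_left (by linarith)]; ring
  · rw [max_eq_left h, max_eq_right (by linarith)]; ring

theorem abs {f : (ι → ℝ) → ℝ} (hf : IsAffine f) : Shallow 2 fun x => |f x| := by
  have h := (relu hf).add (relu hf.neg)
  convert h using 2 with x
  rcases le_total (f x) 0 with h | h
  · rw [max_eq_right h, max_eq_left (by linarith), abs_of_nonpos h]; ring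
  · rw [max_eq_left h, max_eq_right (by linarith), abs_of_nonneg h]; ring

theorem max {f g : (ι → ℝ) → ℝ} (hf : IsAffine f) (hg : IsAffine g) :
    Shallow 3 fun x => Max.max (f x) (g x) := by
  have h := (of_affine hf).add (relu (hg.sub hf))
  convert h using 2 with x
  rcases le_total (f x) (g x) with h | h
  · rw [max_eq_right h, max_eq_left (by linarith)]; ring
  · rw [max_eq_left h, max_eq_right (by linarith)]; ring

/-- Truncation to an interval. -/
theorem clamp {f : (ι → ℝ) → ℝ} (hf : IsAffine f) {a b : ℝ} (hab : a ≤ b) :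
    Shallow 2 fun x => Max.max a (min b (f x)) := by
  -- The truncation of `t` is `a + max (t - a) 0 - max (t - b) 0`.
  have h := ((const (ι := ι) a).add (relu (hf.sub (IsAffine.const a)))).sub
    (relu (hf.sub (IsAffine.const b)))
  convert h using 2 with x
  rcases le_total (f x) a with h | h
  · rw [min_eq_right (by linarith), max_eq_left h, max_eq_right (by linarith),
      max_eq_right (by linarith)]
    ring
  · rcases le_total (f x) b with h' | h'
    · rw [min_eq_right h', max_eq_right h, max_eq_left (by linarith), max_eq_right (by linarith)]
      ring
    · rw [min_eq_left h', max_eq_right hab, max_eq_left (by linarith), max_eq_left (by linarith)]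
      ring

theorem comp {N : ℕ} {f : (κ → ℝ) → ℝ} (hf : Shallow N f) {A : (ι → ℝ) → κ → ℝ}
    (hA : ∀ j, IsAffine fun x => A x j) : Shallow N fun x => f (A x) := by
  obtain ⟨σ, i, c, B, b, hN, hB, hf⟩ := hf
  exact ⟨σ, i, c, fun s x => B s (A x), b, hN, fun s => (hB s).comp hA, fun x => hf _⟩

end Shallow

/-! ### Maxima by networks of fixed width. -/

namespace ReluNet

variable {ι κ : Type} [Fintype ι] [Fintype κ] {w : ℕ}

theorem of_shallow {N : ℕ} {f : (ι → ℝ) → κ → ℝ} (hf : ∀ j, Shallow N fun x => f x j)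
    (hw : Fintype.card κ * N + 1 ≤ w) : ReluNet w 1 f := by
  classical
  choose σ i c A b hN hA hf using hf
  -- The extra neuron `none` is constantly 0; it keeps the hidden layer nonempty and accounts for
  -- the `+ 1` in the width.
  have h := layer (w := w) (L := 0) (κ := κ) (ι := ι) (σ := Option (Σ j, σ j))
    (fun x s => s.elim 0 fun s => A s.1 s.2 x)
    (by
      rintro (_ | s)
      exacts [IsAffine.const 0, hA _ _])
    (by
      rw [Fintype.card_option, Fintype.card_sigma]
      refine le_trans (Nat.add_le_add_right ?_ 1) hw
      calc ∑ j, Fintype.card (σ j) ≤ ∑ _j : κ, N := Finset.sum_le_sum fun j _ => hN j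
        _ = Fintype.card κ * N := by simp)
    (fun y j => ∑ s, c j s * y (some ⟨j, s⟩) + b j)
    (affine _ _ fun j => (IsAffine.sum _ fun s => (IsAffine.coord _).const_mul _).add
      (IsAffine.const _))
  convert h using 1
  funext x j
  simp [hf]

/-- Maxima of finitely many shallow functions are computed one after the other, by a network
whose width does not depend on their number and which keeps its input. -/
theorem sup' {P : Type} (S : Finset P) (hS : S.Nonempty) {M : ℕ} (h : P → κ → (ι → ℝ) → ℝ)
    (hh : ∀ p j, Shallow M (h p j))
    (hw : (Fintype.card ι + 2 * Fintype.card κ) * (M + 3) + 1 ≤ w) :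
    ReluNet w (2 * S.card)
      fun x => Sum.elim x fun j => S.sup' hS fun p => h p j x := by
  classical
  induction hS using Finset.Nonempty.cons_induction with
  | singleton p =>
    refine mono (L := 1) (by simp) (of_shallow (N := M + 3) ?_ (le_trans ?_ hw))
    · rintro (i | j)
      · exact (Shallow.of_affine (IsAffine.coord i)).mono (by omega)
      · simpa using (hh p j).mono (show M ≤ M + 3 by omega)
    · rw [Fintype.card_sum]
      exact Nat.add_le_add_right (Nat.mul_le_mul_right _ (by omega)) 1
  | cons p S hp hS ih =>
    -- One layer computes the new term beside the input and the running maximum, and a second layer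
    -- merges it into that maximum. The bound `M + 3` per output covers a copied value (2), a new
    -- term (`M`) and a binary maximum (3).
    have h₁ : ReluNet w 1 fun z : ι ⊕ κ → ℝ =>
        (Sum.elim z fun j => h p j fun i => z (.inl i) : (ι ⊕ κ) ⊕ κ → ℝ) := by
      refine of_shallow (N := M + 3) ?_ (le_trans ?_ hw)
      · rintro (i | j)
        · exact (Shallow.of_affine (IsAffine.coord i)).mono (by omega)
        · exact ((hh p j).comp fun i => IsAffine.coord _).mono (by omega)
      · simp only [Fintype.card_sum]
        exact Nat.add_le_add_right (Nat.mul_le_mul_right _ (by omega)) 1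
    have h₂ : ReluNet w 1 fun z : (ι ⊕ κ) ⊕ κ → ℝ =>
        (Sum.elim (fun i => z (.inl (.inl i)))
          fun j => max (z (.inr j)) (z (.inl (.inr j))) : ι ⊕ κ → ℝ) := by
      refine of_shallow (N := M + 3) ?_ (le_trans ?_ hw)
      · rintro (i | j)
        · exact (Shallow.of_affine (IsAffine.coord _)).mono (by omega)
        · exact (Shallow.max (IsAffine.coord _) (IsAffine.coord _)).mono (by omega)
      · simp only [Fintype.card_sum]
        exact Nat.add_le_add_right (Nat.mul_le_mul_right _ (by omega)) 1
    have h₃ := (h₂.comp (h₁.comp ih)).mono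
      (show 1 + (1 + 2 * S.card) ≤ 2 * (Finset.cons p S hp).card by
        rw [Finset.card_cons]; omega)
    convert h₃ using 1
    funext x s
    rcases s with i | j
    · simp
    · exact Finset.sup'_cons hS _

end ReluNet

/-! ### Grid approximation of Lipschitz functions and of products. -/

theorem l1norm_sub_comm {n : ℕ} (x y : Fin n → ℝ) : l1norm (x - y) = l1norm (y - x) := by
  simp only [l1norm, Pi.sub_apply, abs_sub_comm]

/-- Equidistant points of an interval. -/
noncomputable def gridPoint (a b : ℝ) (N i : ℕ) : ℝ := a + i * ((b - a) / N)

theorem gridPoint_mem {a b : ℝ} (hab : a ≤ b) {N i : ℕ} (hi : i < N) :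
    gridPoint a b N i ∈ Set.Icc a b := by
  have hN : (0 : ℝ) < N := by exact_mod_cast (Nat.zero_le i).trans_lt hi
  have h : (0 : ℝ) ≤ (b - a) / N := div_nonneg (by linarith) hN.le
  have hi' : (i : ℝ) ≤ N := by exact_mod_cast hi.le
  refine ⟨by unfold gridPoint; nlinarith [Nat.cast_nonneg (α := ℝ) i], ?_⟩
  have := mul_le_mul_of_nonneg_right hi' h
  have h' : (N : ℝ) * ((b - a) / N) = b - a := by field_simp
  unfold gridPoint
  linarith

theorem exists_gridPoint_near {a b : ℝ} {N : ℕ} (hN : 0 < N) {x : ℝ}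
    (hx : x ∈ Set.Icc a b) : ∃ i : Fin N, |x - gridPoint a b N i| ≤ (b - a) / N := by
  have hN' : (0 : ℝ) < N := by exact_mod_cast hN
  rcases (hx.1.trans hx.2).eq_or_lt with rfl | hab
  · refine ⟨⟨0, hN⟩, ?_⟩
    have : x = a := le_antisymm hx.2 hx.1
    simp [gridPoint, this]
  have hs : 0 < (b - a) / N := div_pos (by linarith) hN'
  set s := (b - a) / N with hsdef
  have hNs : N * s = b - a := by rw [hsdef]; field_simp
  -- The grid consists of left endpoints, so `b` is not in it; for `x = b` the last grid point is
  -- exactly one mesh width away.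
  rcases hx.2.eq_or_lt with rfl | hxb
  · refine ⟨⟨N - 1, by omega⟩, ?_⟩
    have : ((N - 1 : ℕ) : ℝ) = N - 1 := by rw [Nat.cast_sub hN]; simp
    simp only [gridPoint, this, ← hsdef]
    rw [show x - (a + (N - 1) * s) = s by linarith, abs_of_pos hs]
  · have h0 : 0 ≤ (x - a) / s := div_nonneg (by linarith [hx.1]) hs.le
    refine ⟨⟨⌊(x - a) / s⌋₊, ?_⟩, ?_⟩
    · rw [Nat.floor_lt h0, div_lt_iff₀ hs, hNs]
      linarith
    · have h1 := Nat.floor_le h0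
      have h2 := Nat.lt_floor_add_one ((x - a) / s)
      rw [le_div_iff₀ hs] at h1
      rw [div_lt_iff₀ hs] at h2
      simp only [gridPoint, ← hsdef]
      rw [abs_le]
      constructor <;> linarith

namespace ReluNet

variable {ι κ : Type} [Fintype ι] [Fintype κ] {w : ℕ}

/-- Functions of `c` of the variables which are Lipschitz on a cube are approximated by maxima
of finitely many functions `x ↦ φ q - ‖x - q‖₁`. -/
theorem exists_lipschitz_approx {c N : ℕ} (hN : 0 < N) {a b : ℝ} (hab : a ≤ b)
    (φ : κ → (Fin c → ℝ) → ℝ)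
    (hφ : ∀ j, ∀ x ∈ cube c a b, ∀ y ∈ cube c a b, |φ j x - φ j y| ≤ l1norm (x - y))
    (s : κ → Fin c → ι)
    (hw : (Fintype.card ι + 2 * Fintype.card κ) * (2 * c + 3) + 1 ≤ w) :
    ∃ G : (ι → ℝ) → κ → ℝ, ReluNet w (2 * N ^ c) (fun x => Sum.elim x (G x)) ∧
      ∀ x, (∀ i, x i ∈ Set.Icc a b) → ∀ j,
        |G x j - φ j (fun t => x (s j t))| ≤ 2 * (c * ((b - a) / N)) := by
  classical
  have : Nonempty (Fin N) := ⟨⟨0, hN⟩⟩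
  let q : (Fin c → Fin N) → Fin c → ℝ := fun p t => gridPoint a b N (p t)
  have hq : ∀ p, q p ∈ cube c a b := fun p t => gridPoint_mem hab (p t).2
  let h : (Fin c → Fin N) → κ → (ι → ℝ) → ℝ :=
    fun p j x => φ j (q p) - l1norm ((fun t => x (s j t)) - q p)
  have hh : ∀ p j, Shallow (2 * c) (h p j) := fun p j => by
    refine ((Shallow.const (φ j (q p))).sub (Shallow.sum (Finset.univ : Finset (Fin c))
      (f := fun t x => |x (s j t) - q p t|) fun t =>
        Shallow.abs ((IsAffine.coord _).sub (IsAffine.const _)))).mono ?_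
    simp [mul_comm]
  refine ⟨fun x j => Finset.univ.sup' Finset.univ_nonempty fun p => h p j x, ?_, ?_⟩
  · simpa using sup' Finset.univ Finset.univ_nonempty h hh hw
  · intro x hx j
    set z : Fin c → ℝ := fun t => x (s j t) with hz
    have hzc : z ∈ cube c a b := fun t => hx _
    -- By the Lipschitz bound every term lies below `φ`, and the term of a nearby grid point falls
    -- short by at most twice its distance to `z`. Hence the factor 2 in the error.
    have hle : ∀ p, h p j x ≤ φ j z := fun p => by
      have := (abs_le.1 (hφ j (q p) (hq p) z hzc)).2
      rw [l1norm_sub_comm] at this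
      simp only [h, ← hz]
      linarith
    choose p hp using fun t => exists_gridPoint_near hN (hzc t)
    have hnear : l1norm (z - q p) ≤ c * ((b - a) / N) := by
      calc l1norm (z - q p) ≤ ∑ _t : Fin c, (b - a) / N :=
            Finset.sum_le_sum fun t _ => hp t
        _ = c * ((b - a) / N) := by simp
    have hge : φ j z - 2 * (c * ((b - a) / N)) ≤ h p j x := by
      have := (abs_le.1 (hφ j z hzc (q p) (hq p))).2
      simp only [h, ← hz]
      linarith
    have h0 : 0 ≤ l1norm (z - q p) := Finset.sum_nonneg fun _ _ => abs_nonneg _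
    rw [abs_le]
    constructor
    · have := hge.trans (Finset.le_sup' (fun p => h p j x) (Finset.mem_univ p))
      linarith
    · have := Finset.sup'_le (s := Finset.univ) Finset.univ_nonempty
        (fun p => h p j x) fun p _ => hle p
      linarith

/-- Products of at most `r` variables are computed one factor after the other, by approximate
multiplications of two numbers. -/
theorem exists_prod_approx {N : ℕ} (hN : 0 < N) (u : ℕ → κ → ι) (act : ℕ → κ → Prop)
    [∀ p j, Decidable (act p j)] (r : ℕ)
    (hw : (Fintype.card ι + 3 * Fintype.card κ) * 7 + 1 ≤ w) :
    ∃ G : (ι → ℝ) → κ → ℝ, ReluNet w (r * (2 * N ^ 2 + 1)) (fun x => Sum.elim x (G x)) ∧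
      ∀ x, (∀ i, x i ∈ Set.Icc (-1 : ℝ) 1) → ∀ j,
        |G x j - ∏ p ∈ Finset.range r, if act p j then x (u p j) else 1| ≤ r * (8 / N) := by
  induction r with
  | zero =>
    refine ⟨fun _ _ => 1, affine _ _ ?_, by simp⟩
    rintro (i | j)
    exacts [IsAffine.coord i, IsAffine.const 1]
  | succ r ih =>
    obtain ⟨G, hG, hGx⟩ := ih
    -- An inactive factor turns multiplication into the first projection, so products of different
    -- lengths run in parallel. On `[-1, 1]²` both functions are 1-Lipschitz, and the error is `2 *
    -- (2 * (2 / N)) = 8 / N`.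
    obtain ⟨M, hM, hMz⟩ := exists_lipschitz_approx (ι := ι ⊕ κ) (κ := κ) (c := 2) (w := w) hN
      (show (-1 : ℝ) ≤ 1 by norm_num)
      (fun j z => if act r j then z 0 * z 1 else z 0)
      (by
        intro j x hx y hy
        have hx1 := abs_le.2 (hx 1)
        have hy0 := abs_le.2 (hy 0)
        simp only [l1norm, Fin.sum_univ_two, Pi.sub_apply]
        split_ifs
        · calc |x 0 * x 1 - y 0 * y 1| = |x 1 * (x 0 - y 0) + y 0 * (x 1 - y 1)| := by
                congr 1; ring
            _ ≤ |x 1 * (x 0 - y 0)| + |y 0 * (x 1 - y 1)| := abs_add_le _ _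
            _ ≤ |x 0 - y 0| + |x 1 - y 1| := by
                rw [abs_mul, abs_mul]
                exact add_le_add (mul_le_of_le_one_left (abs_nonneg _) hx1)
                  (mul_le_of_le_one_left (abs_nonneg _) hy0)
        · linarith [abs_nonneg (x 1 - y 1)])
      (fun j => ![.inr j, .inl (u r j)])
      (by simp only [Fintype.card_sum]; omega)
    -- Approximate partial products may leave `[-1, 1]`, where the next multiplication is
    -- uncontrolled. Truncation costs one layer and no accuracy, as the exact partial product lies
    -- in `[-1, 1]`.
    have hclamp : ReluNet w 1 fun z : ι ⊕ κ → ℝ =>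
        (Sum.elim (fun i => z (.inl i)) fun j => max (-1) (min 1 (z (.inr j))) :
          ι ⊕ κ → ℝ) := by
      refine of_shallow (N := 2) ?_ (by simp only [Fintype.card_sum]; omega)
      rintro (i | j)
      · exact Shallow.of_affine (IsAffine.coord _)
      · exact Shallow.clamp (IsAffine.coord _) (by norm_num)
    have hsel : ReluNet w 0 fun z : (ι ⊕ κ) ⊕ κ → ℝ =>
        (Sum.elim (fun i => z (.inl (.inl i))) fun j => z (.inr j) : ι ⊕ κ → ℝ) := by
      refine affine _ _ ?_
      rintro (i | j) <;> exact IsAffine.coord _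
    let y : (ι → ℝ) → ι ⊕ κ → ℝ := fun x => Sum.elim x fun j => max (-1) (min 1 (G x j))
    refine ⟨fun x => M (y x), ?_, fun x hx j => ?_⟩
    · have h := (hsel.comp (hM.comp (hclamp.comp hG))).mono
        (show 0 + (2 * N ^ 2 + (1 + r * (2 * N ^ 2 + 1))) ≤ (r + 1) * (2 * N ^ 2 + 1) by
          apply le_of_eq; ring)
      convert h using 1
      funext x s
      rcases s with i | j <;> rfl
    · have hy : ∀ i, y x i ∈ Set.Icc (-1 : ℝ) 1 := by
        rintro (i | i)
        · exact hx i
        · exact ⟨le_max_left _ _, max_le (by norm_num) (min_le_left _ _)⟩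
      have h₁ := hMz (y x) hy j
      have h₂ := hGx x hx j
      set π := ∏ p ∈ Finset.range r, if act p j then x (u p j) else 1 with hπ
      have hπ1 : |π| ≤ 1 := by
        rw [hπ, Finset.abs_prod]
        refine Finset.prod_le_one (fun _ _ => abs_nonneg _) fun p _ => ?_
        split_ifs
        · exact abs_le.2 (hx _)
        · simp
      have h₃ : |max (-1) (min 1 (G x j)) - π| ≤ r * (8 / N) := by
        refine le_trans ?_ h₂
        have hcl : max (-1) (min 1 π) = π := by
          rw [min_eq_right (abs_le.1 hπ1).2, max_eq_right (abs_le.1 hπ1).1]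
        calc |max (-1) (min 1 (G x j)) - π|
            = |max (-1) (min 1 (G x j)) - max (-1) (min 1 π)| := by rw [hcl]
          _ ≤ |min 1 (G x j) - min 1 π| := by
              simpa using abs_max_sub_max_le_max (-1) (min 1 (G x j)) (-1) (min 1 π)
          _ ≤ |G x j - π| := by
              simpa using abs_min_sub_min_le_max 1 (G x j) 1 π
      have h₄ : |(if act r j then max (-1) (min 1 (G x j)) * x (u r j)
            else max (-1) (min 1 (G x j))) -
          π * (if act r j then x (u r j) else 1)| ≤ r * (8 / N) := by
        split_ifs
        · rw [← sub_mul, abs_mul]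
          exact (mul_le_of_le_one_right (abs_nonneg _) (abs_le.2 (hx _))).trans h₃
        · simpa using h₃
      rw [Finset.prod_range_succ, ← hπ]
      simp only [Matrix.cons_val_zero, Matrix.cons_val_one, y, Sum.elim_inl, Sum.elim_inr] at h₁
      have h₅ := abs_sub_le (M (y x) j) (if act r j then max (-1) (min 1 (G x j)) * x (u r j)
            else max (-1) (min 1 (G x j))) (π * (if act r j then x (u r j) else 1))
      refine h₅.trans ((add_le_add h₁ h₄).trans (le_of_eq ?_))
      push_cast
      ring

end ReluNet

/-! ### Blocks, parallelizations and Lipschitz constants. -/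

theorem block_mem_cube {m n : ℕ} (δ : Fin n → ℕ) (hδ : ∑ j, δ j = m) {a b : ℝ} {x : Fin m → ℝ}
    (hx : x ∈ cube m a b) (j : Fin n) : block δ hδ x j ∈ cube (δ j) a b := fun _ => hx _

theorem sum_l1norm_block {m n : ℕ} (δ : Fin n → ℕ) (hδ : ∑ j, δ j = m) (x : Fin m → ℝ) :
    ∑ j, l1norm (block δ hδ x j) = l1norm x := by
  subst hδ
  simp only [l1norm, block]
  rw [← Fintype.sum_sigma' (f := fun j t => |x (Fin.cast rfl (finSigmaFinEquiv ⟨j, t⟩))|)]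
  exact Equiv.sum_comp finSigmaFinEquiv fun i => |x i|

/-- Parallelizations of Lipschitz functions are Lipschitz with the same constant. -/
theorem parallelization_lipschitz {m n : ℕ} {δ : Fin n → ℕ} {hδ : ∑ j, δ j = m}
    {f : (j : Fin n) → (Fin (δ j) → ℝ) → ℝ} {a b : ℝ}
    (hf : ∀ j, ∀ x ∈ cube (δ j) a b, ∀ y ∈ cube (δ j) a b, |f j x - f j y| ≤ l1norm (x - y))
    {g : (Fin m → ℝ) → Fin n → ℝ} (hg : Set.EqOn g (parallelization δ hδ f) (cube m a b)) :
    ∀ x ∈ cube m a b, ∀ y ∈ cube m a b, l1norm (g x - g y) ≤ l1norm (x - y) := by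
  intro x hx y hy
  rw [hg hx, hg hy, ← sum_l1norm_block δ hδ (x - y)]
  exact Finset.sum_le_sum fun j _ =>
    hf j _ (block_mem_cube δ hδ hx j) _ (block_mem_cube δ hδ hy j)

theorem abs_iSup_sub_iSup_le {r : ℕ} (hr : 1 ≤ r) (x y : Fin r → ℝ) :
    |(⨆ t, x t) - ⨆ t, y t| ≤ l1norm (x - y) := by
  have : Nonempty (Fin r) := ⟨⟨0, hr⟩⟩
  have key : ∀ x y : Fin r → ℝ, (⨆ t, x t) ≤ (⨆ t, y t) + l1norm (x - y) := fun x y => by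
    refine ciSup_le fun t => ?_
    have h₁ := le_ciSup (Set.finite_range y).bddAbove t
    have h₂ : |(x - y) t| ≤ l1norm (x - y) :=
      Finset.single_le_sum (f := fun t => |(x - y) t|) (fun _ _ => abs_nonneg _)
        (Finset.mem_univ t)
    have h₃ := (abs_le.1 h₂).2
    simp only [Pi.sub_apply] at h₃
    linarith
  have h₁ := key x y
  have h₂ := key y x
  rw [l1norm_sub_comm] at h₂
  rw [abs_le]
  constructor <;> linarith

/-- Replacing one factor at a time, the other factors contribute modulus at most 1. -/
theorem abs_prod_sub_prod_le {r : ℕ} (x y : Fin r → ℝ) (hx : ∀ t, |x t| ≤ 1)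
    (hy : ∀ t, |y t| ≤ 1) : |∏ t, x t - ∏ t, y t| ≤ l1norm (x - y) := by
  induction r with
  | zero => simp [l1norm]
  | succ r ih =>
    have h := ih (fun t => x t.succ) (fun t => y t.succ) (fun t => hx _) fun t => hy _
    simp only [l1norm, Pi.sub_apply] at h ⊢
    rw [Fin.prod_univ_succ, Fin.prod_univ_succ, Fin.sum_univ_succ]
    set X := ∏ t : Fin r, x t.succ
    set Y := ∏ t : Fin r, y t.succ with hY
    have hY1 : |Y| ≤ 1 := by
      rw [hY, Finset.abs_prod]
      exact Finset.prod_le_one (fun _ _ => abs_nonneg _) fun t _ => hy _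
    calc |x 0 * X - y 0 * Y| = |Y * (x 0 - y 0) + x 0 * (X - Y)| := by congr 1; ring
      _ ≤ |Y * (x 0 - y 0)| + |x 0 * (X - Y)| := abs_add_le _ _
      _ ≤ |x 0 - y 0| + |X - Y| := by
          rw [abs_mul, abs_mul]
          exact add_le_add (mul_le_of_le_one_left (abs_nonneg _) hY1)
            (mul_le_of_le_one_left (abs_nonneg _) (hx 0))
      _ ≤ _ := by gcongr

/-- The index `p`, truncated to `{0, …, r - 1}`. -/
def clipIndex {r : ℕ} (hr : 1 ≤ r) (p : ℕ) : Fin r := ⟨min p (r - 1), by omega⟩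

/-- Clipping pads a block by repeating its last coordinate: this does not change a maximum, a
Lipschitz function ignores the padding, and in a product the padded factors are inactive. -/
theorem clipIndex_coe {r : ℕ} (hr : 1 ≤ r) (t : Fin r) : clipIndex hr t = t := by
  ext
  simp only [clipIndex]
  omega

theorem size_le {m n : ℕ} {δ : Fin n → ℕ} (hδ : ∑ j, δ j = m) (j : Fin n) : δ j ≤ m :=
  hδ ▸ Finset.single_le_sum (f := δ) (fun _ _ => Nat.zero_le _) (Finset.mem_univ j)

theorem l1norm_le_of_forall {n : ℕ} {x : Fin n → ℝ} {r : ℝ} (h : ∀ j, |x j| ≤ r) :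
    l1norm x ≤ n * r := by
  calc l1norm x ≤ ∑ _j : Fin n, r := Finset.sum_le_sum fun j _ => h j
    _ = n * r := by simp

/-! ### Networks for the three kinds of maps. -/

theorem exists_net_of_lipschitzParallel {m n c N w : ℕ} (hN : 0 < N) {a b : ℝ} (hab : a ≤ b)
    {g : (Fin m → ℝ) → Fin n → ℝ} (hg : IsLipschitzParallel c 1 a b g)
    (hw : (m + 2 * n) * (2 * c + 3) + 1 ≤ w) :
    ∃ G : (Fin m → ℝ) → Fin n → ℝ, ReluNet w (2 * N ^ c) G ∧
      ∀ x ∈ cube m a b, l1norm (G x - g x) ≤ n * (2 * (c * ((b - a) / N))) := by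
  obtain ⟨-, δ, hδ, f, hδc, hf, hgf⟩ := hg
  obtain ⟨G, hG, hGx⟩ := ReluNet.exists_lipschitz_approx (ι := Fin m) (κ := Fin n) (c := c)
    (w := w) hN hab (fun j z => f j fun t => z (Fin.castLE (hδc j).2 t))
    (by
      intro j x hx y hy
      refine (hf j _ (fun t => hx _) _ fun t => hy _).trans ?_
      rw [one_mul]
      simp only [l1norm, Pi.sub_apply]
      have h := Finset.sum_map Finset.univ (Fin.castLEEmb (hδc j).2) fun t => |x t - y t|
      simp only [Fin.coe_castLEEmb] at h
      rw [← h]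
      exact Finset.sum_le_univ_sum_of_nonneg fun _ => abs_nonneg _)
    (fun j t => Fin.cast hδ (finSigmaFinEquiv ⟨j, clipIndex (hδc j).1 t⟩))
    (by simpa using hw)
  refine ⟨G, ?_, fun x hx => l1norm_le_of_forall fun j => ?_⟩
  · have h := (ReluNet.affine (w := w) 0 (fun (z : Fin m ⊕ Fin n → ℝ) j => z (.inr j))
      fun j => IsAffine.coord _).comp hG
    simpa using h
  · have h := hGx x hx j
    rw [Pi.sub_apply, hgf hx]
    simp only [Fin.val_castLE, clipIndex_coe] at h
    exact h

theorem exists_net_of_maxParallel {m n w : ℕ} (hm : 1 ≤ m) {a b : ℝ}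
    {g : (Fin m → ℝ) → Fin n → ℝ} (hg : IsMaxParallel a b g)
    (hw : (m + 2 * n) * 5 + 1 ≤ w) :
    ∃ G : (Fin m → ℝ) → Fin n → ℝ, ReluNet w (2 * m) G ∧ ∀ x ∈ cube m a b, G x = g x := by
  obtain ⟨-, δ, hδ, hδ1, hgf⟩ := hg
  have : Nonempty (Fin m) := ⟨⟨0, hm⟩⟩
  have hG := ReluNet.sup' (w := w) (M := 2) (Finset.univ : Finset (Fin m))
    Finset.univ_nonempty (fun p j x => block δ hδ x j (clipIndex (hδ1 j) p))
    (fun p j => Shallow.of_affine (IsAffine.coord _)) (by simpa using hw)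
  have h := (ReluNet.affine (w := w) 0 (fun (z : Fin m ⊕ Fin n → ℝ) j => z (.inr j))
      fun j => IsAffine.coord _).comp hG
  refine ⟨_, by simpa using h, fun x hx => ?_⟩
  rw [hgf hx]
  funext j
  have : Nonempty (Fin (δ j)) := ⟨⟨0, hδ1 j⟩⟩
  refine le_antisymm (Finset.sup'_le _ _ fun p _ => ?_) (ciSup_le fun t => ?_)
  · exact le_ciSup (Set.finite_range (block δ hδ x j)).bddAbove _
  · refine le_trans (le_of_eq ?_) (Finset.le_sup' _
      (Finset.mem_univ (Fin.castLE (size_le hδ j) t)))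
    simp [clipIndex_coe]

theorem exists_net_of_prodParallel {m n N w : ℕ} (hN : 0 < N) {a b : ℝ} (ha : -1 ≤ a)
    (hb : b ≤ 1) {g : (Fin m → ℝ) → Fin n → ℝ} (hg : IsProdParallel a b g)
    (hw : (m + 3 * n) * 7 + 1 ≤ w) :
    ∃ G : (Fin m → ℝ) → Fin n → ℝ, ReluNet w (m * (2 * N ^ 2 + 1)) G ∧
      ∀ x ∈ cube m a b, l1norm (G x - g x) ≤ n * (m * (8 / N)) := by
  classical
  obtain ⟨-, δ, hδ, hδ1, hgf⟩ := hg
  obtain ⟨G, hG, hGx⟩ := ReluNet.exists_prod_approx (ι := Fin m) (κ := Fin n) (w := w) hN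
    (fun p j => Fin.cast hδ (finSigmaFinEquiv ⟨j, clipIndex (hδ1 j) p⟩))
    (fun p j => p < δ j) m (by simpa using hw)
  refine ⟨G, ?_, fun x hx => l1norm_le_of_forall fun j => ?_⟩
  · have h := (ReluNet.affine (w := w) 0 (fun (z : Fin m ⊕ Fin n → ℝ) j => z (.inr j))
      fun j => IsAffine.coord _).comp hG
    simpa using h
  · have h := hGx x (fun i => ⟨ha.trans (hx i).1, (hx i).2.trans hb⟩) j
    rw [Pi.sub_apply, hgf hx]
    convert h using 3
    have hsub : Finset.range (δ j) ⊆ Finset.range m :=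
      Finset.range_subset_range.2 (size_le hδ j)
    rw [← Finset.prod_subset hsub fun p _ hp => if_neg (by simpa using hp),
      Finset.prod_range]
    refine Finset.prod_congr rfl fun t _ => ?_
    rw [if_pos t.2, clipIndex_coe]
    rfl

/-- The three kinds of maps that are composed. -/
def IsBuildingBlock (c : ℕ) {m n : ℕ} (a b : ℝ) (g : (Fin m → ℝ) → Fin n → ℝ) : Prop :=
  IsLipschitzParallel c 1 a b g ∨ IsMaxParallel a b g ∨
    IsProdParallel a b g ∧ -1 ≤ a ∧ b ≤ 1

namespace IsBuildingBlock

variable {c m n : ℕ} {a b : ℝ} {g : (Fin m → ℝ) → Fin n → ℝ}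

theorem lipschitz (hg : IsBuildingBlock c a b g) :
    ∀ x ∈ cube m a b, ∀ y ∈ cube m a b, l1norm (g x - g y) ≤ l1norm (x - y) := by
  rcases hg with ⟨-, δ, hδ, f, -, hf, hgf⟩ | ⟨-, δ, hδ, hδ1, hgf⟩ | ⟨⟨-, δ, hδ, -, hgf⟩, ha, hb⟩
  · exact parallelization_lipschitz (by simpa using hf) hgf
  · exact parallelization_lipschitz (fun j x _ y _ => abs_iSup_sub_iSup_le (hδ1 j) x y) hgf
  · have h1 : ∀ j, ∀ x ∈ cube (δ j) a b, ∀ t, |x t| ≤ 1 := fun j x hx t =>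
      abs_le.2 ⟨ha.trans (hx t).1, (hx t).2.trans hb⟩
    exact parallelization_lipschitz
      (fun j x hx y hy => abs_prod_sub_prod_le x y (h1 j x hx) (h1 j y hy)) hgf

/-- Uniform bounds for all three kinds. The exponent `2 * c` dominates both `c` (Lipschitz grids)
and 2 (multiplication grids). The products dictate the width, through `(B + 3 * B) * 7`, and the
factor 3 in the depth, through `2 * N ^ 2 + 1`. -/
theorem exists_net (hg : IsBuildingBlock c a b g) (hc : 1 ≤ c) (hab : a ≤ b) {N B : ℕ}
    (hN : 0 < N) (hm : 1 ≤ m) (hmB : m ≤ B) (hnB : n ≤ B) (habB : b - a ≤ 2 * B) :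
    ∃ G : (Fin m → ℝ) → Fin n → ℝ, ReluNet (28 * (c * B) + 1) (3 * B * N ^ (2 * c)) G ∧
      ∀ x ∈ cube m a b, l1norm (G x - g x) ≤ 8 * c * B ^ 2 / N := by
  have hN' : (0 : ℝ) < N := by exact_mod_cast hN
  have hB1 : 1 ≤ B := hm.trans hmB
  have hBc : B ≤ c * B := Nat.le_mul_of_pos_left _ hc
  have hpow : ∀ e, e ≤ 2 * c → N ^ e ≤ N ^ (2 * c) := fun e he => Nat.pow_le_pow_right hN he
  have hmB' : (m : ℝ) ≤ B := by exact_mod_cast hmB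
  have hnB' : (n : ℝ) ≤ B := by exact_mod_cast hnB
  have hc' : (1 : ℝ) ≤ c := by exact_mod_cast hc
  rcases hg with hg | hg | ⟨hg, ha, hb⟩
  · obtain ⟨G, hG, hGx⟩ := exists_net_of_lipschitzParallel (w := 28 * (c * B) + 1) hN hab hg
      (by
        calc (m + 2 * n) * (2 * c + 3) + 1 ≤ (B + 2 * B) * (2 * c + 3) + 1 := by gcongr
          _ = 6 * (c * B) + 9 * B + 1 := by ring
          _ ≤ 28 * (c * B) + 1 := by omega)
    refine ⟨G, hG.mono ?_, fun x hx => (hGx x hx).trans ?_⟩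
    · have := hpow c (by omega)
      calc 2 * N ^ c ≤ 3 * 1 * N ^ (2 * c) := by omega
        _ ≤ 3 * B * N ^ (2 * c) := by gcongr
    · calc (n : ℝ) * (2 * (c * ((b - a) / N))) ≤ B * (2 * (c * ((2 * B) / N))) := by
            have : 0 ≤ (b - a) / N := div_nonneg (by linarith) hN'.le
            gcongr
        _ = 4 * c * B ^ 2 / N := by ring
        _ ≤ 8 * c * B ^ 2 / N := by gcongr; norm_num
  · obtain ⟨G, hG, hGx⟩ := exists_net_of_maxParallel (w := 28 * (c * B) + 1) hm hg (by omega)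
    refine ⟨G, hG.mono ?_, fun x hx => ?_⟩
    · calc 2 * m ≤ 3 * B * 1 := by omega
        _ ≤ 3 * B * N ^ (2 * c) := by gcongr; exact Nat.one_le_pow _ _ hN
    · rw [hGx x hx]
      simp only [l1norm, sub_self, Pi.zero_apply, abs_zero, Finset.sum_const_zero]
      positivity
  · obtain ⟨G, hG, hGx⟩ := exists_net_of_prodParallel (w := 28 * (c * B) + 1) hN ha hb hg
      (by omega)
    refine ⟨G, hG.mono ?_, fun x hx => (hGx x hx).trans ?_⟩
    · have h₁ := hpow 2 (by omega)
      have h₂ := hpow 0 (by omega)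
      calc m * (2 * N ^ 2 + 1) ≤ B * (3 * N ^ (2 * c)) := by
            apply Nat.mul_le_mul hmB
            rw [pow_zero] at h₂
            omega
        _ = 3 * B * N ^ (2 * c) := by ring
    · calc (n : ℝ) * (m * (8 / N)) ≤ B * (B * (8 / N)) := by gcongr
        _ = 8 * 1 * B ^ 2 / N := by ring
        _ ≤ 8 * c * B ^ 2 / N := by gcongr

end IsBuildingBlock

/-! ### Error propagation along the composition. -/

/-- The coordinatewise projection onto a cube. -/
noncomputable def clampCube (a b : ℝ) {n : ℕ} (x : Fin n → ℝ) : Fin n → ℝ :=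
  fun i => max a (min b (x i))

theorem clampCube_mem {a b : ℝ} (hab : a ≤ b) {n : ℕ} (x : Fin n → ℝ) :
    clampCube a b x ∈ cube n a b :=
  fun _ => ⟨le_max_left _ _, max_le hab (min_le_left _ _)⟩

theorem l1norm_clampCube_sub_le {a b : ℝ} {n : ℕ} (x : Fin n → ℝ) {y : Fin n → ℝ}
    (hy : y ∈ cube n a b) : l1norm (clampCube a b x - y) ≤ l1norm (x - y) := by
  refine Finset.sum_le_sum fun i _ => ?_
  have hcl : max a (min b (y i)) = y i := by
    rw [min_eq_right (hy i).2, max_eq_right (hy i).1]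
  simp only [Pi.sub_apply, clampCube]
  calc |max a (min b (x i)) - y i| = |max a (min b (x i)) - max a (min b (y i))| := by rw [hcl]
    _ ≤ |min b (x i) - min b (y i)| := by
        simpa using abs_max_sub_max_le_max a (min b (x i)) a (min b (y i))
    _ ≤ |x i - y i| := by simpa using abs_min_sub_min_le_max b (x i) b (y i)

theorem l1norm_sub_le {n : ℕ} (x y z : Fin n → ℝ) :
    l1norm (x - z) ≤ l1norm (x - y) + l1norm (y - z) := by
  simp only [l1norm, ← Finset.sum_add_distrib, Pi.sub_apply]
  exact Finset.sum_le_sum fun i _ => abs_sub_le _ _ _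

/-- Errors add up along a composition of maps which are `1`-Lipschitz for the `ℓ₁`-norm, if the
networks approximating them are separated by projections onto the respective cubes. -/
theorem exists_net_compose {D : ℕ → ℕ} {g : (i : ℕ) → (Fin (D i) → ℝ) → (Fin (D (i + 1)) → ℝ)}
    {k : ℕ} {a b : ℕ → ℝ} (hab : ∀ i < k, a i ≤ b i)
    (hlip : ∀ i < k, ∀ x ∈ cube (D i) (a i) (b i), ∀ y ∈ cube (D i) (a i) (b i),
      l1norm (g i x - g i y) ≤ l1norm (x - y))
    (hmaps : ∀ i, i + 1 < k → Set.MapsTo (g i) (cube (D i) (a i) (b i))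
      (cube (D (i + 1)) (a (i + 1)) (b (i + 1))))
    {w L : ℕ} {e : ℝ} (hw : ∀ i < k, D i * 2 + 1 ≤ w)
    (hnet : ∀ i < k, ∃ G : (Fin (D i) → ℝ) → Fin (D (i + 1)) → ℝ, ReluNet w L G ∧
      ∀ x ∈ cube (D i) (a i) (b i), l1norm (G x - g i x) ≤ e) :
    ∃ G : (Fin (D 0) → ℝ) → Fin (D k) → ℝ, ReluNet w (k * (L + 1)) G ∧
      ∀ x ∈ cube (D 0) (a 0) (b 0), l1norm (G x - compose D g k x) ≤ k * e := by
  have hmem : ∀ i < k, ∀ x ∈ cube (D 0) (a 0) (b 0),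
      compose D g i x ∈ cube (D i) (a i) (b i) := by
    intro i
    induction i with
    | zero => exact fun _ x hx => hx
    | succ i ih => exact fun hi x hx => hmaps i hi (ih (by omega) x hx)
  suffices h : ∀ i ≤ k, ∃ G : (Fin (D 0) → ℝ) → Fin (D i) → ℝ, ReluNet w (i * (L + 1)) G ∧
      ∀ x ∈ cube (D 0) (a 0) (b 0), l1norm (G x - compose D g i x) ≤ i * e from h k le_rfl
  intro i
  induction i with
  | zero =>
    refine fun _ => ⟨fun x => x, .affine _ _ fun j => IsAffine.coord j, fun x _ => ?_⟩
    simp [compose, l1norm]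
  | succ i ih =>
    intro hi
    obtain ⟨G, hG, hGx⟩ := ih (by omega)
    obtain ⟨H, hH, hHx⟩ := hnet i hi
    have hcl : ReluNet w 1 (clampCube (a i) (b i) (n := D i)) :=
      .of_shallow (N := 2) (fun j => Shallow.clamp (IsAffine.coord j) (hab i hi))
        (by simpa using hw i hi)
    refine ⟨fun x => H (clampCube (a i) (b i) (G x)), (hH.comp (hcl.comp hG)).mono ?_,
      fun x hx => ?_⟩
    · apply le_of_eq
      ring
    · have hy := clampCube_mem (hab i hi) (G x)
      have hz := hmem i hi x hx
      -- Compare through `g i` at the projected point: the network error there is at most `e`, and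
      -- the Lipschitz bound carries over the earlier error.
      calc l1norm (H (clampCube (a i) (b i) (G x)) - g i (compose D g i x))
          ≤ e + l1norm (clampCube (a i) (b i) (G x) - compose D g i x) :=
            (l1norm_sub_le _ (g i (clampCube (a i) (b i) (G x))) _).trans
              (add_le_add (hHx _ hy) (hlip i hi _ hy _ hz))
        _ ≤ e + i * e := by
            gcongr
            exact (l1norm_clampCube_sub_le _ hz).trans (hGx x hx)
        _ = ((i + 1 : ℕ) : ℝ) * e := by push_cast; ring

theorem le_and_le_of_cube_subset {m : ℕ} (hm : 1 ≤ m) {a b r s : ℝ} (hab : a ≤ b)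
    (h : cube m a b ⊆ cube m r s) : r ≤ a ∧ b ≤ s :=
  ⟨(h (show (fun _ => a) ∈ cube m a b from fun _ => ⟨le_rfl, hab⟩) ⟨0, hm⟩).1,
    (h (show (fun _ => b) ∈ cube m a b from fun _ => ⟨hab, le_rfl⟩) ⟨0, hm⟩).2⟩

/-! ### Parameter count and the theorem. -/

/-- Size of a network with `k` stages, each using `N` grid points per coordinate. -/
theorem numParams_bound {c k B N : ℕ} (hc : 1 ≤ c) (hB : 1 ≤ B) (hkB : k ≤ B) (hN : 1 ≤ N) :
    (k * (3 * B * N ^ (2 * c) + 1) + 1) * ((28 * (c * B) + 1) * (28 * (c * B) + 1 + 1)) ≤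
      4350 * c ^ 2 * B ^ 4 * N ^ (2 * c) := by
  have hM : 1 ≤ N ^ (2 * c) := Nat.one_le_pow _ _ hN
  generalize N ^ (2 * c) = M at hM ⊢
  have hcB : 1 ≤ c * B := Nat.mul_pos hc hB
  have hBM : 1 ≤ B * M := Nat.mul_pos hB hM
  have hBBM : 1 ≤ B * (B * M) := Nat.mul_pos hB hBM
  calc (k * (3 * B * M + 1) + 1) * ((28 * (c * B) + 1) * (28 * (c * B) + 1 + 1))
      ≤ (5 * (B * (B * M))) * ((29 * (c * B)) * (30 * (c * B))) := by
        refine Nat.mul_le_mul ?_ (Nat.mul_le_mul (by omega) (by omega))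
        have : k * (3 * B * M + 1) ≤ B * (4 * (B * M)) :=
          Nat.mul_le_mul hkB (by rw [mul_assoc]; omega)
        rw [mul_left_comm] at this
        omega
    _ = 4350 * c ^ 2 * B ^ 4 * M := by ring

end DNNApprox

/-- Indices of the composition start at `0`: for every `d ≥ 1` the composed functions are
`g d 0, …, g d (k d - 1)`, where `g d i` maps the cube `[a d i, b d i]^(D d i)` to `ℝ^(D d (i+1))`.
Functions are total; only their values on these cubes matter. -/
theorem theorem1p1 (c : ℕ) (hc : 1 ≤ c)
    (k : ℕ → ℕ) (hk : ∀ d, 1 ≤ d → 1 ≤ k d ∧ k d ≤ c * d ^ c)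
    (D : ℕ → ℕ → ℕ)
    (hD : ∀ d, 1 ≤ d → ∀ i, i ≤ k d → 1 ≤ D d i ∧ D d i ≤ c * d ^ c)
    (a b : ℕ → ℕ → ℝ)
    (hab : ∀ d, 1 ≤ d → ∀ i, i < k d → a d i < b d i)
    (hQ : ∀ d, 1 ≤ d → ∀ i, i < k d →
      DNNApprox.cube (D d i) (a d i) (b d i) ⊆
        DNNApprox.cube (D d i) (-((c : ℝ) * (d : ℝ) ^ c)) ((c : ℝ) * (d : ℝ) ^ c))
    (g : (d i : ℕ) → (Fin (D d i) → ℝ) → (Fin (D d (i + 1)) → ℝ))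
    (hg : ∀ d, 1 ≤ d → ∀ i, i < k d →
      DNNApprox.IsLipschitzParallel c 1 (a d i) (b d i) (g d i) ∨
      DNNApprox.IsMaxParallel (a d i) (b d i) (g d i) ∨
      DNNApprox.IsProdParallel (a d i) (b d i) (g d i))
    (hmaps : ∀ d, 1 ≤ d → ∀ i, i + 1 < k d →
      Set.MapsTo (g d i) (DNNApprox.cube (D d i) (a d i) (b d i))
        (DNNApprox.cube (D d (i + 1)) (a d (i + 1)) (b d (i + 1))))
    (hprod : ∀ d, 1 ≤ d → ∀ i, i < k d →
      DNNApprox.IsProdParallel (a d i) (b d i) (g d i) →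
      DNNApprox.cube (D d i) (a d i) (b d i) ⊆ DNNApprox.cube (D d i) (-(1 / 8)) (1 / 8))
    (F : (d : ℕ) → (Fin (D d 0) → ℝ) → (Fin (D d (k d)) → ℝ))
    (hF : ∀ d, 1 ≤ d → Set.EqOn (F d) (DNNApprox.compose (D d) (g d) (k d))
      (DNNApprox.cube (D d 0) (a d 0) (b d 0))) :
    ∃ K : ℕ, 1 ≤ K ∧ ∀ d : ℕ, 1 ≤ d → ∀ ε : ℝ, 0 < ε → ε ≤ 1 →
      ∃ Φ : DNNApprox.DNN (D d 0) (D d (k d)),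
        Continuous Φ.realize ∧
        (Φ.numParams : ℝ) ≤ (K : ℝ) * (d : ℝ) ^ K * ε ^ (-(2 * (c : ℤ))) ∧
        ∀ x ∈ DNNApprox.cube (D d 0) (a d 0) (b d 0),
          DNNApprox.l1norm (Φ.realize x - F d x) ≤ ε := by

  set C : ℕ := 4350 * c ^ 2 * (9 * c) ^ (2 * c) * c ^ (6 * c + 4) with hC
  have hC1 : 1 ≤ C := Nat.succ_le_of_lt (by positivity)
  -- `K` serves both as coefficient and as exponent, so it is the sum of the constant `C` and the
  -- degree in `d`.
  refine ⟨C + c * (6 * c + 4), by omega, fun d hd ε hε hε1 => ?_⟩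
  set B : ℕ := c * d ^ c with hB
  have hB1 : 1 ≤ B := (hk d hd).1.trans (hk d hd).2
  have hB1' : (1 : ℝ) ≤ B := by exact_mod_cast hB1
  have hc' : (1 : ℝ) ≤ c := by exact_mod_cast hc
  have hd' : (1 : ℝ) ≤ d := by exact_mod_cast hd
  have hkB : ((k d : ℕ) : ℝ) ≤ B := by exact_mod_cast (hk d hd).2
  have hBcast : ((c : ℝ) * (d : ℝ) ^ c) = B := by rw [hB]; push_cast; rfl
  -- Chosen so that `B` stages with error `8 * c * B ^ 2 / q` each give exactly `ε`.
  set q : ℝ := 8 * c * B ^ 3 / ε with hq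
  have hq0 : 0 < q := by positivity
  -- Absorbs the rounding up of `q`, turning the constant 8 into 9.
  have hq1 : (1 : ℝ) ≤ c * B ^ 3 / ε := by
    rw [le_div_iff₀ hε]
    calc 1 * ε ≤ 1 * 1 ^ 3 := by linarith
      _ ≤ c * B ^ 3 := by gcongr
  set N : ℕ := ⌈q⌉₊ with hN
  have hN0 : 0 < N := Nat.ceil_pos.2 hq0
  have hN' : (0 : ℝ) < N := by exact_mod_cast hN0
  have hqN : q ≤ N := Nat.le_ceil q
  have hNq : (N : ℝ) ≤ 9 * c * B ^ 3 / ε := by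
    have h₁ := (Nat.ceil_lt_add_one hq0.le).le
    have h₂ : 9 * c * B ^ 3 / ε = q + c * B ^ 3 / ε := by rw [hq]; ring
    rw [h₂]
    linarith
  have hab' : ∀ i < k d, a d i ≤ b d i := fun i hi => (hab d hd i hi).le
  have hblock : ∀ i < k d, DNNApprox.IsBuildingBlock c (a d i) (b d i) (g d i) := by
    intro i hi
    rcases hg d hd i hi with h | h | h
    · exact .inl h
    · exact .inr (.inl h)
    -- Of the bound `1 / 8` only containment in `[-1, 1]` is needed.
    · have := DNNApprox.le_and_le_of_cube_subset (hD d hd i hi.le).1 (hab' i hi)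
        (hprod d hd i hi h)
      exact .inr (.inr ⟨h, by linarith, by linarith⟩)
  obtain ⟨G, hG, hGx⟩ := DNNApprox.exists_net_compose (D := D d) (g := g d) (k := k d)
    (a := a d) (b := b d) hab' (fun i hi => (hblock i hi).lipschitz) (hmaps d hd)
    (w := 28 * (c * B) + 1) (L := 3 * B * N ^ (2 * c)) (e := 8 * c * B ^ 2 / N)
    (fun i hi => by
      have h₁ := (hD d hd i hi.le).2
      have h₂ : B ≤ c * B := Nat.le_mul_of_pos_left _ hc
      omega)
    (fun i hi => (hblock i hi).exists_net hc (hab' i hi) hN0 (hD d hd i hi.le).1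
      (hD d hd i hi.le).2 (hD d hd (i + 1) hi).2 (by
        have := DNNApprox.le_and_le_of_cube_subset (hD d hd i hi.le).1 (hab' i hi)
          (hQ d hd i hi)
        rw [hBcast] at this
        linarith))
  have hwidth : ∀ i ≤ k d, D d i ≤ 28 * (c * B) + 1 := fun i hi => by
    have h₁ := (hD d hd i hi).2
    have h₂ : B ≤ c * B := Nat.le_mul_of_pos_left _ hc
    omega
  obtain ⟨Φ, hΦ, hP⟩ := hG.exists_dnn (Equiv.refl _) (Equiv.refl _) (hD d hd 0 (by omega)).1
    (hD d hd _ le_rfl).1 (hwidth 0 (by omega)) (hwidth _ le_rfl)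
  refine ⟨Φ, Φ.continuous_realize, ?_, fun x hx => ?_⟩
  · have h₁ := hP.trans (DNNApprox.numParams_bound hc hB1 (hk d hd).2 hN0)
    have h₂ : (Φ.numParams : ℝ) ≤ 4350 * c ^ 2 * B ^ 4 * N ^ (2 * c) := by exact_mod_cast h₁
    calc (Φ.numParams : ℝ) ≤ 4350 * c ^ 2 * B ^ 4 * N ^ (2 * c) := h₂
      _ ≤ 4350 * c ^ 2 * B ^ 4 * (9 * c * B ^ 3 / ε) ^ (2 * c) := by gcongr
      _ = 4350 * c ^ 2 * (9 * c) ^ (2 * c) * B ^ (6 * c + 4) * (ε ^ (2 * c))⁻¹ := by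
          rw [div_pow, mul_pow, ← pow_mul]
          ring
      _ = C * (d : ℝ) ^ (c * (6 * c + 4)) * (ε ^ (2 * c))⁻¹ := by
          rw [hC, ← hBcast, mul_pow (c : ℝ), ← pow_mul (d : ℝ)]
          push_cast
          ring
      _ ≤ ((C + c * (6 * c + 4) : ℕ) : ℝ) * (d : ℝ) ^ (C + c * (6 * c + 4)) *
          (ε ^ (2 * c))⁻¹ := by
          gcongr
          · omega
          · omega
      _ = _ := by
          rw [zpow_neg]
          norm_cast
  · rw [hF d hd hx, hΦ]
    refine (hGx x hx).trans ?_
    calc (k d : ℝ) * (8 * c * B ^ 2 / N) ≤ B * (8 * c * B ^ 2 / q) := by gcongr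
      _ = ε := by
          rw [hq]
          field_simp
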